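/- Consider first-order functional logic programs with call-time choice. Expressions are built from variables, the symbol $\bot$, and saturated applications of constructors and of operations (defined functions). A *value* is an expression without operations, variables and $\bot$; a *partial value* is an expression without operations and variables (it may contain $\bot$). A program is a set of rules $f\,t_1\ldots t_n = r$, where $f$ is an operation, the $t_i$ are patterns (terms built from constructors and variables) and $r$ is an expression. The reduction relation $\to$ is the closure under contexts of the two rules $f\,\sigma(t_1)\ldots\sigma(t_n)\to\sigma(r)$, for a program rule $f\,t_1\ldots t_n=r$ and a substitution $\sigma$ that maps each variable to a partial value, and $e\to\bot$, for $e\neq\bot$; $\to^*$ is its reflexive and transitive closure. Two operations $f_1,f_2$ of the same arity are *equivalent* if for every expression $E_1$ and every value $v$, $E_1\to^* v$ if and only if $E_2\to^* v$, where $E_2$ is obtained from $E_1$ by replacing each occurrence of $f_1$ with $f_2$. Consider a program that contains the following rules: sort [] = [] sort (x:xs) = case minRest x [] xs of (m,r) -> m : sort r minRest m rs [] = (m,rs) minRest m rs (y:ys) = if m<=y then minRest m (y:rs) ys else minRest y (m:rs) ys sort'spec xs | sorted ys = ys where ys = perm xs sorted [] = True sorted [_] = True sorted (x:y:zs) = x<=y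 && sorted (y:zs) perm [] = [] perm (x:xs) = insert x (perm xs) insert x ys = x : ys insert x (y:ys) = y : insert x ys Here `<=` is the comparison of integer constants, `True && b = b`, `False && b = False`; `if`, the condition, the `case` and the `where` stand for auxiliary operations: `if True then a else b = a`, `if False then a else b = b`; `ifthen True a = a`; the second rule of `sort` is `sort (x:xs) = sortCase (minRest x [] xs)` with `sortCase (m,r) = m : sort r`; and `sort'spec xs = sortSpecWhere (perm xs)` with `sortSpecWhere ys = ifthen (sorted ys) ys`. The program may declare arbitrary further constructors and contain arbitrary rules for further operations (which may call the operations above), but it contains no other rules for the operations above. Then the operations `sort` and `sort'spec` are equivalent. -/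

import Mathlib

universe u

namespace FLP

/-! ### Functional logic programs with call-time choice -/

/-- A signature: data constructors and operations (defined functions), with their arities. -/
structure Signature where
  Con : Type u
  conArity : Con → ℕ
  Op : Type u
  opArity : Op → ℕ

/-- Expressions: the symbol `⊥`, variables, saturated constructor applications and saturated
operation applications. -/
inductive Expr (S : Signature.{u}) : Type u
  | bot : Expr S
  | var (x : ℕ) : Expr S
  | con (c : S.Con) (args : Fin (S.conArity c) → Expr S) : Expr S
  | op (f : S.Op) (args : Fin (S.opArity f) → Expr S) : Expr S

/-- Patterns: terms built from variables and constructors only. -/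
inductive Pat (S : Signature.{u}) : Type u
  | var (x : ℕ) : Pat S
  | con (c : S.Con) (args : Fin (S.conArity c) → Pat S) : Pat S

variable {S : Signature.{u}}

/-- A value: an expression without operations, without variables and without `⊥`. -/
inductive IsValue : Expr S → Prop
  | con (c : S.Con) (args : Fin (S.conArity c) → Expr S) :
      (∀ i, IsValue (args i)) → IsValue (.con c args)

/-- A partial value: an expression without operations and variables; `⊥` is permitted. -/
inductive IsPartialValue : Expr S → Prop
  | bot : IsPartialValue .bot
  | con (c : S.Con) (args : Fin (S.conArity c) → Expr S) :
      (∀ i, IsPartialValue (args i)) → IsPartialValue (.con c args)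

/-- Application of a substitution to an expression. -/
def Expr.subst (σ : ℕ → Expr S) : Expr S → Expr S
  | .bot => .bot
  | .var x => σ x
  | .con c args => .con c (fun i => (args i).subst σ)
  | .op f args => .op f (fun i => (args i).subst σ)

/-- Application of a substitution to a pattern. -/
def Pat.subst (σ : ℕ → Expr S) : Pat S → Expr S
  | .var x => σ x
  | .con c args => .con c (fun i => (args i).subst σ)

/-- A program rule `head pats₁ … patsₙ = rhs`. -/
structure Rule (S : Signature.{u}) where
  head : S.Op
  pats : Fin (S.opArity head) → Pat S
  rhs : Expr S

/-- One reduction step with respect to the program `P`.  The constructors `conArg` and `opArg`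
close the rules (Fun) and (Bot) under contexts. -/
inductive Step (P : Set (Rule S)) : Expr S → Expr S → Prop
  | rule (ρ : Rule S) (hρ : ρ ∈ P) (σ : ℕ → Expr S) (hσ : ∀ x, IsPartialValue (σ x)) :
      Step P (.op ρ.head (fun i => (ρ.pats i).subst σ)) (ρ.rhs.subst σ)
  | bot (e : Expr S) (he : e ≠ .bot) : Step P e .bot
  | conArg (c : S.Con) (args : Fin (S.conArity c) → Expr S) (i : Fin (S.conArity c))
      (e : Expr S) (h : Step P (args i) e) :
      Step P (.con c args) (.con c (Function.update args i e))
  | opArg (f : S.Op) (args : Fin (S.opArity f) → Expr S) (i : Fin (S.opArity f))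
      (e : Expr S) (h : Step P (args i) e) :
      Step P (.op f args) (.op f (Function.update args i e))

/-- The reflexive and transitive closure of the reduction relation. -/
def Derives (P : Set (Rule S)) : Expr S → Expr S → Prop :=
  Relation.ReflTransGen (Step P)

open Classical in
/-- `E.replaceOp f₁ f₂ h` is obtained from `E` by replacing each occurrence of the operation
`f₁` with the operation `f₂` of the same arity. -/
noncomputable def Expr.replaceOp (f₁ f₂ : S.Op) (h : S.opArity f₁ = S.opArity f₂) :
    Expr S → Expr S
  | .bot => .bot
  | .var x => .var x
  | .con c args => .con c (fun i => (args i).replaceOp f₁ f₂ h)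
  | .op f args =>
      if hf : f = f₁ then
        .op f₂ (fun i => (args (Fin.cast (by rw [hf, h]) i)).replaceOp f₁ f₂ h)
      else .op f (fun i => (args i).replaceOp f₁ f₂ h)

/-- (Contextual) equivalence of two operations in the program `P`: every expression derives
the same values after replacing each occurrence of `f₁` in it with `f₂`. -/
def Equivalent (P : Set (Rule S)) (f₁ f₂ : S.Op) (h : S.opArity f₁ = S.opArity f₂) : Prop :=
  ∀ E v : Expr S, IsValue v → (Derives P E v ↔ Derives P (E.replaceOp f₁ f₂ h) v)

/-! ### The sorting program -/

/-- The constructors of lists, pairs, Booleans and integers. -/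
inductive BaseCon : Type u
  | nil
  | cons
  | pair
  | tt
  | ff
  | int (z : ℤ)

abbrev BaseCon.arity : BaseCon.{u} → ℕ
  | .cons => 2
  | .pair => 2
  | _ => 0

/-- The operations of the sorting program.  `leq` and `and` are the infix operations `<=` and
`&&`, `ite` is `if _ then _ else _`, and `ifthen` implements conditional rules.  `sortCase` is
the `case` expression in the definition of `sort`, and `sortSpecWhere` is the body of
`sortSpec` below the `where` binding, as a function of the shared variable `ys`. -/
inductive BaseOp : Type u
  | leq
  | and
  | ite
  | ifthen
  | insert
  | perm
  | sorted
  | sortSpec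
  | sortSpecWhere
  | minRest
  | sort
  | sortCase

abbrev BaseOp.arity : BaseOp.{u} → ℕ
  | .leq => 2
  | .and => 2
  | .ite => 3
  | .ifthen => 2
  | .insert => 2
  | .perm => 1
  | .sorted => 1
  | .sortSpec => 1
  | .sortSpecWhere => 1
  | .minRest => 3
  | .sort => 1
  | .sortCase => 1

/-- The signature of the sorting program, extended by further constructors and operations. -/
abbrev sortSig (S : Signature.{u}) : Signature.{u} where
  Con := BaseCon.{u} ⊕ S.Con
  conArity := Sum.elim BaseCon.arity S.conArity
  Op := BaseOp.{u} ⊕ S.Op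
  opArity := Sum.elim BaseOp.arity S.opArity

section Terms

variable (S)

abbrev bcon (c : BaseCon.{u}) (args : Fin c.arity → Expr (sortSig S)) : Expr (sortSig S) :=
  .con (S := sortSig S) (Sum.inl c) args

abbrev bop (f : BaseOp.{u}) (args : Fin f.arity → Expr (sortSig S)) : Expr (sortSig S) :=
  .op (S := sortSig S) (Sum.inl f) args

abbrev pcon (c : BaseCon.{u}) (args : Fin c.arity → Pat (sortSig S)) : Pat (sortSig S) :=
  .con (S := sortSig S) (Sum.inl c) args

abbrev brule (f : BaseOp.{u}) (pats : Fin f.arity → Pat (sortSig S)) (rhs : Expr (sortSig S)) :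
    Rule (sortSig S) where
  head := Sum.inl f
  pats := pats
  rhs := rhs

end Terms

/-- The rules of the sorting program, in each case preceded by the source text. -/
inductive SortRule (S : Signature.{u}) : Rule (sortSig S) → Prop
  /-- `i <= j = True`, for integers `i ≤ j` -/
  | leq_tt (i j : ℤ) (h : i ≤ j) :
      SortRule S (brule S .leq ![pcon S (.int i) ![], pcon S (.int j) ![]] (bcon S .tt ![]))
  /-- `i <= j = False`, for integers `i > j` -/
  | leq_ff (i j : ℤ) (h : j < i) :
      SortRule S (brule S .leq ![pcon S (.int i) ![], pcon S (.int j) ![]] (bcon S .ff ![]))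
  /-- `True && b = b` -/
  | and_tt : SortRule S (brule S .and ![pcon S .tt ![], .var 0] (.var 0))
  /-- `False && _ = False` -/
  | and_ff : SortRule S (brule S .and ![pcon S .ff ![], .var 0] (bcon S .ff ![]))
  /-- `if True then a else b = a` -/
  | ite_tt : SortRule S (brule S .ite ![pcon S .tt ![], .var 0, .var 1] (.var 0))
  /-- `if False then a else b = b` -/
  | ite_ff : SortRule S (brule S .ite ![pcon S .ff ![], .var 0, .var 1] (.var 1))
  /-- `ifthen True a = a` -/
  | ifthen_tt : SortRule S (brule S .ifthen ![pcon S .tt ![], .var 0] (.var 0))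
  /-- `insert x ys = x : ys` -/
  | insert_here :
      SortRule S (brule S .insert ![.var 0, .var 1] (bcon S .cons ![.var 0, .var 1]))
  /-- `insert x (y:ys) = y : insert x ys` -/
  | insert_there :
      SortRule S (brule S .insert ![.var 0, pcon S .cons ![.var 1, .var 2]]
        (bcon S .cons ![.var 1, bop S .insert ![.var 0, .var 2]]))
  /-- `perm [] = []` -/
  | perm_nil : SortRule S (brule S .perm ![pcon S .nil ![]] (bcon S .nil ![]))
  /-- `perm (x:xs) = insert x (perm xs)` -/
  | perm_cons :
      SortRule S (brule S .perm ![pcon S .cons ![.var 0, .var 1]]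
        (bop S .insert ![.var 0, bop S .perm ![.var 1]]))
  /-- `sorted [] = True` -/
  | sorted_nil : SortRule S (brule S .sorted ![pcon S .nil ![]] (bcon S .tt ![]))
  /-- `sorted [_] = True` -/
  | sorted_one :
      SortRule S (brule S .sorted ![pcon S .cons ![.var 0, pcon S .nil ![]]] (bcon S .tt ![]))
  /-- `sorted (x:y:zs) = x <= y && sorted (y:zs)` -/
  | sorted_cons :
      SortRule S (brule S .sorted ![pcon S .cons ![.var 0, pcon S .cons ![.var 1, .var 2]]]
        (bop S .and ![bop S .leq ![.var 0, .var 1],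
          bop S .sorted ![bcon S .cons ![.var 1, .var 2]]]))
  /-- `sort'spec xs = sortSpecWhere ys  where ys = perm xs` -/
  | sortSpec : SortRule S (brule S .sortSpec ![.var 0] (bop S .sortSpecWhere ![bop S .perm ![.var 0]]))
  /-- `sortSpecWhere ys | sorted ys = ys` -/
  | sortSpecWhere :
      SortRule S (brule S .sortSpecWhere ![.var 0]
        (bop S .ifthen ![bop S .sorted ![.var 0], .var 0]))
  /-- `minRest m rs [] = (m,rs)` -/
  | minRest_nil :
      SortRule S (brule S .minRest ![.var 0, .var 1, pcon S .nil ![]]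
        (bcon S .pair ![.var 0, .var 1]))
  /-- `minRest m rs (y:ys) = if m <= y then minRest m (y:rs) ys else minRest y (m:rs) ys` -/
  | minRest_cons :
      SortRule S (brule S .minRest ![.var 0, .var 1, pcon S .cons ![.var 2, .var 3]]
        (bop S .ite ![bop S .leq ![.var 0, .var 2],
          bop S .minRest ![.var 0, bcon S .cons ![.var 2, .var 1], .var 3],
          bop S .minRest ![.var 2, bcon S .cons ![.var 0, .var 1], .var 3]]))
  /-- `sort [] = []` -/
  | sort_nil : SortRule S (brule S .sort ![pcon S .nil ![]] (bcon S .nil ![]))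
  /-- `sort (x:xs) = case minRest x [] xs of (m,r) -> …` -/
  | sort_cons :
      SortRule S (brule S .sort ![pcon S .cons ![.var 0, .var 1]]
        (bop S .sortCase ![bop S .minRest ![.var 0, bcon S .nil ![], .var 1]]))
  /-- `(m,r) -> m : sort r` -/
  | sortCase :
      SortRule S (brule S .sortCase ![pcon S .pair ![.var 0, .var 1]]
        (bcon S .cons ![.var 0, bop S .sort ![.var 1]]))

/-- The sorting program as a set of rules. -/
def sortProgram (S : Signature.{u}) : Set (Rule (sortSig S)) := {ρ | SortRule S ρ}

end FLP

/-! Reduction to a partial value coincides with a big-step evaluation `Eval`, in which every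
expression may evaluate to ⊥ and rule variables are bound to partial values (`derives_iff_eval`).
Evaluation is compositional: an application depends on its arguments only through the partial values
they evaluate to. Hence two operations with the same evaluations on all arguments are
interchangeable in every context (`equivalent_of_eval_iff`). Partial results have to be compared
too, since a context may use only part of a result.

Both operations have the same non-⊥ results, described by `EvalSorted`. Neither yields more than ⊥
before the whole spine of its argument is known: the specification has to check `sorted`, and
`minRest` returns its pair only at the end of the list. With two or more elements, each element
takes part in a comparison and is therefore an integer; with at most one element nothing is
compared, and a single element may be any partial value.

For the specification, `perm` yields exactly the permutations, up to replacing subterms by ⊥, and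
`sorted` accepts exactly the `IntLE`-chains (`eval_sortSpec_iff_evalSorted`). For `sort`, selection
sort on integers is deterministic and computes `List.insertionSort`, because sorted permutations are
unique (`eval_sort_iff_evalSorted`). -/

namespace FLP

/-! ### Big-step semantics and its agreement with reduction -/

section Semantics

variable {S : Signature.{u}} {P : Set (Rule S)}

/-- Big-step evaluation to partial values. -/
inductive Eval (P : Set (Rule S)) : Expr S → Expr S → Prop
  | bot (e : Expr S) : Eval P e .bot
  | con (c : S.Con) (args vals : Fin (S.conArity c) → Expr S)
      (h : ∀ i, Eval P (args i) (vals i)) : Eval P (.con c args) (.con c vals)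
  | op (f : S.Op) (pats : Fin (S.opArity f) → Pat S) (rhs : Expr S)
      (hρ : (⟨f, pats, rhs⟩ : Rule S) ∈ P) (σ : ℕ → Expr S) (hσ : ∀ x, IsPartialValue (σ x))
      (args : Fin (S.opArity f) → Expr S) (t : Expr S)
      (h : ∀ i, Eval P (args i) ((pats i).subst σ)) (hr : Eval P (rhs.subst σ) t) :
      Eval P (.op f args) t

theorem IsValue.isPartialValue {v : Expr S} (h : IsValue v) : IsPartialValue v := by
  induction h with
  | con c args _ ih => exact .con c args ih

theorem Pat.isPartialValue_subst {σ : ℕ → Expr S} (hσ : ∀ x, IsPartialValue (σ x)) (p : Pat S) :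
    IsPartialValue (p.subst σ) := by
  induction p with
  | var x => exact hσ x
  | con c args ih => exact .con c _ ih

theorem Eval.isPartialValue {e t : Expr S} (h : Eval P e t) : IsPartialValue t := by
  induction h with
  | bot e => exact .bot
  | con c args vals _ ih => exact .con c vals ih
  | op _ _ _ _ _ _ _ _ _ _ _ ih => exact ih

theorem IsPartialValue.eval_self {t : Expr S} (h : IsPartialValue t) : Eval P t t := by
  induction h with
  | bot => exact .bot _
  | con c args _ ih => exact .con c args args ih

theorem eval_bot_iff {t : Expr S} : Eval P .bot t ↔ t = .bot :=
  ⟨fun h => by cases h; rfl, by rintro rfl; exact .bot _⟩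

theorem eval_con_iff {c : S.Con} {args : Fin (S.conArity c) → Expr S} {t : Expr S} :
    Eval P (.con c args) t ↔
      t = .bot ∨ ∃ vals, t = .con c vals ∧ ∀ i, Eval P (args i) (vals i) := by
  constructor
  · intro h
    cases h with
    | bot => exact .inl rfl
    | con _ _ vals h => exact .inr ⟨vals, rfl, h⟩
  · rintro (rfl | ⟨vals, rfl, h⟩)
    · exact .bot _
    · exact .con c args vals h

theorem eval_con_con {c : S.Con} {args vals : Fin (S.conArity c) → Expr S} :
    Eval P (.con c args) (.con c vals) ↔ ∀ i, Eval P (args i) (vals i) := by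
  constructor
  · intro h
    cases h with
    | con _ _ _ h => exact h
  · exact .con c args vals

theorem eval_op_iff {f : S.Op} {args : Fin (S.opArity f) → Expr S} {t : Expr S} :
    Eval P (.op f args) t ↔
      t = .bot ∨ ∃ pats rhs, (⟨f, pats, rhs⟩ : Rule S) ∈ P ∧ ∃ σ : ℕ → Expr S,
        (∀ x, IsPartialValue (σ x)) ∧ (∀ i, Eval P (args i) ((pats i).subst σ)) ∧
        Eval P (rhs.subst σ) t := by
  constructor
  · intro h
    cases h with
    | bot => exact .inl rfl
    | op _ pats rhs hρ σ hσ _ _ h hr => exact .inr ⟨pats, rhs, hρ, σ, hσ, h, hr⟩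
  · rintro (rfl | ⟨pats, rhs, hρ, σ, hσ, h, hr⟩)
    · exact .bot _
    · exact .op f pats rhs hρ σ hσ args t h hr

/-- On partial values evaluation can only replace subterms by ⊥, so this says that the set of
results of an expression is closed under loss of information. -/
theorem Eval.trans {e t t' : Expr S} (h : Eval P e t) (h' : Eval P t t') : Eval P e t' := by
  induction h generalizing t' with
  | bot e => exact eval_bot_iff.1 h' ▸ .bot e
  | con c args vals _ ih =>
    rcases eval_con_iff.1 h' with rfl | ⟨vals', rfl, hv⟩
    · exact .bot _
    · exact .con c _ _ fun i => ih i (hv i)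
  | op f pats rhs hρ σ hσ args t h _ _ ih => exact .op f pats rhs hρ σ hσ args _ h (ih h')

theorem Eval.op_mono {f : S.Op} {args args' : Fin (S.opArity f) → Expr S} {t : Expr S}
    (hargs : ∀ i u, Eval P (args i) u → Eval P (args' i) u) (h : Eval P (.op f args) t) :
    Eval P (.op f args') t := by
  rcases eval_op_iff.1 h with rfl | ⟨pats, rhs, hρ, σ, hσ, h, hr⟩
  · exact .bot _
  · exact .op f pats rhs hρ σ hσ _ _ (fun i => hargs i _ (h i)) hr

theorem Eval.con_mono {c : S.Con} {args args' : Fin (S.conArity c) → Expr S} {t : Expr S}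
    (hargs : ∀ i u, Eval P (args i) u → Eval P (args' i) u) (h : Eval P (.con c args) t) :
    Eval P (.con c args') t := by
  rcases eval_con_iff.1 h with rfl | ⟨vals, rfl, hv⟩
  · exact .bot _
  · exact .con c _ _ fun i => hargs i _ (hv i)

/-- A step never creates results: after a rule step the patterns are matched by partial values,
which evaluate to themselves, and contexts are handled by monotonicity. -/
theorem Step.eval {e e' t : Expr S} (h : Step P e e') (h' : Eval P e' t) : Eval P e t := by
  induction h generalizing t with
  | rule ρ hρ σ hσ =>
    exact .op ρ.head ρ.pats ρ.rhs hρ σ hσ _ t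
      (fun i => (Pat.isPartialValue_subst hσ _).eval_self) h'
  | bot e he => exact eval_bot_iff.1 h' ▸ .bot e
  | conArg c args i e _ ih =>
    refine h'.con_mono fun j u hu => ?_
    by_cases hj : j = i
    · subst hj
      exact ih (by simpa using hu)
    · simpa [hj] using hu
  | opArg f args i e _ ih =>
    refine h'.op_mono fun j u hu => ?_
    by_cases hj : j = i
    · subst hj
      exact ih (by simpa using hu)
    · simpa [hj] using hu

theorem Derives.bot (e : Expr S) : Derives P e .bot := by
  by_cases h : e = .bot
  · subst h
    exact .refl
  · exact .single (.bot e h)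

/-- Closure under one-position contexts gives closure under changing all positions. -/
theorem derives_of_update {n : ℕ} (K : (Fin n → Expr S) → Expr S)
    (hK : ∀ args i e, Step P (args i) e → Step P (K args) (K (Function.update args i e)))
    {args vals : Fin n → Expr S} (h : ∀ i, Derives P (args i) (vals i)) :
    Derives P (K args) (K vals) := by
  have single : ∀ (args : Fin n → Expr S) i e, Derives P (args i) e →
      Derives P (K args) (K (Function.update args i e)) := by
    intro args i e he
    induction he with
    | refl =>
      rw [Function.update_eq_self]
      exact .refl
    | @tail b c _ hbc ih =>
      refine ih.tail ?_
      simpa using hK (Function.update args i b) i c (by simpa using hbc)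
  -- The set `s` holds the positions already reduced; it grows by one position at a time.
  have key : ∀ s : Finset (Fin n), Derives P (K args) (K (s.piecewise vals args)) := by
    intro s
    induction s using Finset.induction_on with
    | empty =>
      rw [Finset.piecewise_empty]
      exact .refl
    | insert a s ha ih =>
      rw [Finset.piecewise_insert]
      exact ih.trans (single _ _ _ (by simpa [ha] using h a))
  simpa using key Finset.univ

theorem Eval.derives {e t : Expr S} (h : Eval P e t) : Derives P e t := by
  induction h with
  | bot e => exact Derives.bot e
  | con c args vals _ ih => exact derives_of_update (Expr.con c) (Step.conArg c) ih
  | op f pats rhs hρ σ hσ args t _ _ ih ihr =>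
    exact (derives_of_update (Expr.op f) (Step.opArg f) ih).trans
      (.head (Step.rule ⟨f, pats, rhs⟩ hρ σ hσ) ihr)

theorem derives_iff_eval {e t : Expr S} (ht : IsPartialValue t) : Derives P e t ↔ Eval P e t := by
  refine ⟨fun h => ?_, Eval.derives⟩
  induction h using Relation.ReflTransGen.head_induction_on with
  | refl => exact ht.eval_self
  | head h _ ih => exact h.eval ih

/-- Compositionality carries the agreement of the two operations through every surrounding
constructor and operation. -/
theorem eval_replaceOp_iff {f₁ f₂ : S.Op} {h : S.opArity f₁ = S.opArity f₂}
    (H : ∀ args t, Eval P (.op f₁ args) t ↔ Eval P (.op f₂ fun i => args (Fin.cast h.symm i)) t)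
    (e t : Expr S) : Eval P e t ↔ Eval P (e.replaceOp f₁ f₂ h) t := by
  induction e generalizing t with
  | bot => rfl
  | var x => rfl
  | con c args ih =>
    exact ⟨.con_mono fun i u => (ih i u).1, .con_mono fun i u => (ih i u).2⟩
  | op f args ih =>
    rw [Expr.replaceOp]
    split_ifs with hf
    · subst hf
      rw [H]
      exact ⟨.op_mono fun i u => (ih _ u).1, .op_mono fun i u => (ih _ u).2⟩
    · exact ⟨.op_mono fun i u => (ih i u).1, .op_mono fun i u => (ih i u).2⟩

/-- Operations with the same evaluations are equivalent. -/
theorem equivalent_of_eval_iff {f₁ f₂ : S.Op} {h : S.opArity f₁ = S.opArity f₂}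
    (H : ∀ args t, Eval P (.op f₁ args) t ↔ Eval P (.op f₂ fun i => args (Fin.cast h.symm i)) t) :
    Equivalent P f₁ f₂ h := fun E v hv => by
  rw [derives_iff_eval hv.isPartialValue, derives_iff_eval hv.isPartialValue]
  exact eval_replaceOp_iff H E v

end Semantics

theorem forall_fin_three {p : Fin 3 → Prop} : (∀ i, p i) ↔ p 0 ∧ p 1 ∧ p 2 := by
  simp only [Fin.forall_fin_succ, IsEmpty.forall_iff, and_true]
  rfl

/-! ### Terms of the sorting program and their substitution instances -/

section Terms

variable {S : Signature.{u}}

abbrev eCons (a b : Expr (sortSig S)) : Expr (sortSig S) := bcon S .cons ![a, b]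
abbrev ePair (a b : Expr (sortSig S)) : Expr (sortSig S) := bcon S .pair ![a, b]
/-! Notation for the terms of the sorting program. -/

abbrev eNil : Expr (sortSig S) := bcon S .nil ![]
abbrev eTrue : Expr (sortSig S) := bcon S .tt ![]
abbrev eFalse : Expr (sortSig S) := bcon S .ff ![]
abbrev eInt (z : ℤ) : Expr (sortSig S) := bcon S (.int z) ![]
abbrev eLeq (a b : Expr (sortSig S)) : Expr (sortSig S) := bop S .leq ![a, b]
abbrev eIte (a b c : Expr (sortSig S)) : Expr (sortSig S) := bop S .ite ![a, b, c]
abbrev eIfthen (a b : Expr (sortSig S)) : Expr (sortSig S) := bop S .ifthen ![a, b]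
abbrev eInsert (a b : Expr (sortSig S)) : Expr (sortSig S) := bop S .insert ![a, b]
abbrev ePerm (a : Expr (sortSig S)) : Expr (sortSig S) := bop S .perm ![a]
abbrev eSorted (a : Expr (sortSig S)) : Expr (sortSig S) := bop S .sorted ![a]
abbrev eSortSpec (a : Expr (sortSig S)) : Expr (sortSig S) := bop S .sortSpec ![a]
abbrev eSortSpecWhere (a : Expr (sortSig S)) : Expr (sortSig S) := bop S .sortSpecWhere ![a]
abbrev eMinRest (a b c : Expr (sortSig S)) : Expr (sortSig S) := bop S .minRest ![a, b, c]
abbrev eSort (a : Expr (sortSig S)) : Expr (sortSig S) := bop S .sort ![a]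
abbrev eSortCase (a : Expr (sortSig S)) : Expr (sortSig S) := bop S .sortCase ![a]
abbrev eAnd (a b : Expr (sortSig S)) : Expr (sortSig S) := bop S .and ![a, b]

theorem subst_eCons (σ : ℕ → Expr (sortSig S)) (a b : Expr (sortSig S)) :
    (eCons a b).subst σ = eCons (a.subst σ) (b.subst σ) :=
  congrArg (Expr.con (S := sortSig S) (.inl .cons)) (funext (Fin.forall_fin_two.2 ⟨rfl, rfl⟩))

theorem subst_ePair (σ : ℕ → Expr (sortSig S)) (a b : Expr (sortSig S)) :
    (ePair a b).subst σ = ePair (a.subst σ) (b.subst σ) :=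
  congrArg (Expr.con (S := sortSig S) (.inl .pair)) (funext (Fin.forall_fin_two.2 ⟨rfl, rfl⟩))

theorem subst_eNil (σ : ℕ → Expr (sortSig S)) :
    (eNil : Expr (sortSig S)).subst σ = eNil :=
  congrArg (Expr.con (S := sortSig S) (.inl .nil)) (funext (fun i => i.elim0))

theorem subst_eTrue (σ : ℕ → Expr (sortSig S)) :
    (eTrue : Expr (sortSig S)).subst σ = eTrue :=
  congrArg (Expr.con (S := sortSig S) (.inl .tt)) (funext (fun i => i.elim0))

theorem subst_eFalse (σ : ℕ → Expr (sortSig S)) :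
    (eFalse : Expr (sortSig S)).subst σ = eFalse :=
  congrArg (Expr.con (S := sortSig S) (.inl .ff)) (funext (fun i => i.elim0))

theorem subst_eLeq (σ : ℕ → Expr (sortSig S)) (a b : Expr (sortSig S)) :
    (eLeq a b).subst σ = eLeq (a.subst σ) (b.subst σ) :=
  congrArg (Expr.op (S := sortSig S) (.inl .leq)) (funext (Fin.forall_fin_two.2 ⟨rfl, rfl⟩))

theorem subst_eIte (σ : ℕ → Expr (sortSig S)) (a b c : Expr (sortSig S)) :
    (eIte a b c).subst σ = eIte (a.subst σ) (b.subst σ) (c.subst σ) :=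
  congrArg (Expr.op (S := sortSig S) (.inl .ite)) (funext (forall_fin_three.2 ⟨rfl, rfl, rfl⟩))

theorem subst_eIfthen (σ : ℕ → Expr (sortSig S)) (a b : Expr (sortSig S)) :
    (eIfthen a b).subst σ = eIfthen (a.subst σ) (b.subst σ) :=
  congrArg (Expr.op (S := sortSig S) (.inl .ifthen)) (funext (Fin.forall_fin_two.2 ⟨rfl, rfl⟩))

theorem subst_eInsert (σ : ℕ → Expr (sortSig S)) (a b : Expr (sortSig S)) :
    (eInsert a b).subst σ = eInsert (a.subst σ) (b.subst σ) :=
  congrArg (Expr.op (S := sortSig S) (.inl .insert)) (funext (Fin.forall_fin_two.2 ⟨rfl, rfl⟩))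

theorem subst_ePerm (σ : ℕ → Expr (sortSig S)) (a : Expr (sortSig S)) :
    (ePerm a).subst σ = ePerm (a.subst σ) :=
  congrArg (Expr.op (S := sortSig S) (.inl .perm)) (funext (Fin.forall_fin_one.2 rfl))

theorem subst_eSorted (σ : ℕ → Expr (sortSig S)) (a : Expr (sortSig S)) :
    (eSorted a).subst σ = eSorted (a.subst σ) :=
  congrArg (Expr.op (S := sortSig S) (.inl .sorted)) (funext (Fin.forall_fin_one.2 rfl))

theorem subst_eSortSpecWhere (σ : ℕ → Expr (sortSig S)) (a : Expr (sortSig S)) :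
    (eSortSpecWhere a).subst σ = eSortSpecWhere (a.subst σ) :=
  congrArg (Expr.op (S := sortSig S) (.inl .sortSpecWhere)) (funext (Fin.forall_fin_one.2 rfl))

theorem subst_eMinRest (σ : ℕ → Expr (sortSig S)) (a b c : Expr (sortSig S)) :
    (eMinRest a b c).subst σ = eMinRest (a.subst σ) (b.subst σ) (c.subst σ) :=
  congrArg (Expr.op (S := sortSig S) (.inl .minRest)) (funext (forall_fin_three.2 ⟨rfl, rfl, rfl⟩))

theorem subst_eSort (σ : ℕ → Expr (sortSig S)) (a : Expr (sortSig S)) :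
    (eSort a).subst σ = eSort (a.subst σ) :=
  congrArg (Expr.op (S := sortSig S) (.inl .sort)) (funext (Fin.forall_fin_one.2 rfl))

theorem subst_eSortCase (σ : ℕ → Expr (sortSig S)) (a : Expr (sortSig S)) :
    (eSortCase a).subst σ = eSortCase (a.subst σ) :=
  congrArg (Expr.op (S := sortSig S) (.inl .sortCase)) (funext (Fin.forall_fin_one.2 rfl))

theorem subst_eAnd (σ : ℕ → Expr (sortSig S)) (a b : Expr (sortSig S)) :
    (eAnd a b).subst σ = eAnd (a.subst σ) (b.subst σ) :=
  congrArg (Expr.op (S := sortSig S) (.inl .and)) (funext (Fin.forall_fin_two.2 ⟨rfl, rfl⟩))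

theorem subst_pcon_cons (σ : ℕ → Expr (sortSig S)) (a b : Pat (sortSig S)) :
    (pcon S .cons ![a, b]).subst σ = eCons (a.subst σ) (b.subst σ) :=
  congrArg (Expr.con (S := sortSig S) (.inl .cons)) (funext (Fin.forall_fin_two.2 ⟨rfl, rfl⟩))

theorem subst_pcon_pair (σ : ℕ → Expr (sortSig S)) (a b : Pat (sortSig S)) :
    (pcon S .pair ![a, b]).subst σ = ePair (a.subst σ) (b.subst σ) :=
  congrArg (Expr.con (S := sortSig S) (.inl .pair)) (funext (Fin.forall_fin_two.2 ⟨rfl, rfl⟩))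

theorem subst_pcon_nil (σ : ℕ → Expr (sortSig S)) :
    (pcon S .nil ![]).subst σ = eNil :=
  congrArg (Expr.con (S := sortSig S) (.inl .nil)) (funext (fun i => i.elim0))

theorem subst_pcon_tt (σ : ℕ → Expr (sortSig S)) :
    (pcon S .tt ![]).subst σ = eTrue :=
  congrArg (Expr.con (S := sortSig S) (.inl .tt)) (funext (fun i => i.elim0))

theorem subst_pcon_ff (σ : ℕ → Expr (sortSig S)) :
    (pcon S .ff ![]).subst σ = eFalse :=
  congrArg (Expr.con (S := sortSig S) (.inl .ff)) (funext (fun i => i.elim0))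

theorem subst_pcon_int (σ : ℕ → Expr (sortSig S)) (z : ℤ) :
    (pcon S (.int z) ![]).subst σ = eInt z :=
  congrArg (Expr.con (S := sortSig S) (.inl (.int z))) (funext (fun i => i.elim0))

/-- The substitution of the terms of a list for the first variables and of `⊥` for the others. -/
def listSubst (l : List (Expr (sortSig S))) (x : ℕ) : Expr (sortSig S) := l.getD x .bot

theorem isPartialValue_listSubst {l : List (Expr (sortSig S))} (hl : ∀ e ∈ l, IsPartialValue e)
    (x : ℕ) : IsPartialValue (listSubst l x) := by
  rw [listSubst, List.getD_eq_getElem?_getD]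
  cases h : l[x]? with
  | none => exact .bot
  | some e => exact hl e (List.mem_of_getElem? h)

end Terms

/-! ### Evaluation of constructor terms -/

section Constructors

variable {S : Signature.{u}} {Q : Set (Rule (sortSig S))} {a b c d t : Expr (sortSig S)}

theorem eval_eCons_iff : Eval Q (eCons a b) t ↔
    t = .bot ∨ ∃ a' b', t = eCons a' b' ∧ Eval Q a a' ∧ Eval Q b b' := by
  refine eval_con_iff.trans (or_congr_right ⟨?_, ?_⟩)
  · rintro ⟨v, rfl, h⟩
    exact ⟨v (0 : Fin 2), v (1 : Fin 2), congrArg _ (funext (Fin.forall_fin_two.2 ⟨rfl, rfl⟩)),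
      h (0 : Fin 2), h (1 : Fin 2)⟩
  · rintro ⟨a', b', rfl, ha, hb⟩
    exact ⟨_, rfl, Fin.forall_fin_two.2 ⟨ha, hb⟩⟩

theorem eval_eCons_eCons : Eval Q (eCons a b) (eCons c d) ↔ Eval Q a c ∧ Eval Q b d :=
  eval_con_con.trans Fin.forall_fin_two

theorem eval_ePair_ePair : Eval Q (ePair a b) (ePair c d) ↔ Eval Q a c ∧ Eval Q b d :=
  eval_con_con.trans Fin.forall_fin_two

theorem eval_eNil : Eval Q eNil (eNil (S := S)) := eval_con_con.2 fun i => i.elim0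

theorem eval_eTrue : Eval Q eTrue (eTrue (S := S)) := eval_con_con.2 fun i => i.elim0

theorem eval_eFalse : Eval Q eFalse (eFalse (S := S)) := eval_con_con.2 fun i => i.elim0

theorem eval_eInt (z : ℤ) : Eval Q (eInt z) (eInt (S := S) z) := eval_con_con.2 fun i => i.elim0

theorem isPartialValue_eCons_iff :
    IsPartialValue (eCons a b) ↔ IsPartialValue a ∧ IsPartialValue b := by
  constructor
  · intro h
    cases h with
    | con _ _ h => exact ⟨h (0 : Fin 2), h (1 : Fin 2)⟩
  · exact fun h => .con _ _ (Fin.forall_fin_two.2 h)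

/-- A constant has no proper approximation except ⊥, and ⊥ evaluates only to itself. -/
theorem IsPartialValue.eq_eInt (ht : IsPartialValue t) {z : ℤ} (h : Eval Q t (eInt z)) :
    t = eInt z := by
  cases ht with
  | bot => cases h
  | con _ args =>
    cases h
    exact congrArg _ (funext fun i => i.elim0)

theorem IsPartialValue.eq_eNil (ht : IsPartialValue t) (h : Eval Q t eNil) : t = eNil := by
  cases ht with
  | bot => cases h
  | con _ args =>
    cases h
    exact congrArg _ (funext fun i => i.elim0)

theorem IsPartialValue.exists_eq_eCons (ht : IsPartialValue t) (h : Eval Q t (eCons a b)) :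
    ∃ a' b', t = eCons a' b' ∧ IsPartialValue a' ∧ IsPartialValue b' ∧
      Eval Q a' a ∧ Eval Q b' b := by
  cases ht with
  | bot => cases h
  | con _ args hargs =>
    cases h with
    | con _ _ _ h =>
      exact ⟨args (0 : Fin 2), args (1 : Fin 2),
        congrArg _ (funext (Fin.forall_fin_two.2 ⟨rfl, rfl⟩)),
        hargs _, hargs _, h (0 : Fin 2), h (1 : Fin 2)⟩

end Constructors

/-! ### One unfolding equivalence for each operation -/

section Unfolding

variable {S : Signature.{u}} {Q : Set (Rule (sortSig S))}

/-- The rules of `Q` for the operations of the sorting program are those of that program. -/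
def ExtendsSort (Q : Set (Rule (sortSig S))) : Prop :=
  ∀ f pats rhs, (⟨.inl f, pats, rhs⟩ : Rule (sortSig S)) ∈ Q ↔ SortRule S ⟨.inl f, pats, rhs⟩

theorem extendsSort_union {P : Set (Rule (sortSig S))}
    (hP : ∀ ρ ∈ P, ∃ f : S.Op, ρ.head = Sum.inr f) : ExtendsSort (sortProgram S ∪ P) := by
  refine fun f pats rhs => ⟨fun h => h.resolve_right fun h' => ?_, .inl⟩
  obtain ⟨g, hg⟩ := hP _ h'
  cases hg

theorem Eval.congr_right {a t t' : Expr (sortSig S)} (h : Eval Q a t) (ht : t = t') :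
    Eval Q a t' := ht ▸ h

theorem eval_of_rule (hQ : ExtendsSort Q) {f : BaseOp.{u}} {pats : Fin f.arity → Pat (sortSig S)}
    {rhs : Expr (sortSig S)} (hρ : SortRule S (brule S f pats rhs)) (l : List (Expr (sortSig S)))
    (hl : ∀ e ∈ l, IsPartialValue e) {args : Fin f.arity → Expr (sortSig S)}
    {t : Expr (sortSig S)} (h : ∀ i, Eval Q (args i) ((pats i).subst (listSubst l)))
    (hr : Eval Q (rhs.subst (listSubst l)) t) : Eval Q (bop S f args) t :=
  .op (S := sortSig S) (.inl f) pats rhs ((hQ _ _ _).2 hρ) _ (isPartialValue_listSubst hl) _ _ h hr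

theorem exists_rule_of_eval (hQ : ExtendsSort Q) {f : BaseOp.{u}}
    {args : Fin f.arity → Expr (sortSig S)} {t : Expr (sortSig S)} (h : Eval Q (bop S f args) t) :
    t = .bot ∨ ∃ pats rhs, SortRule S (brule S f pats rhs) ∧ ∃ σ : ℕ → Expr (sortSig S),
      (∀ i, Eval Q (args i) ((pats i).subst σ)) ∧ Eval Q (rhs.subst σ) t := by
  obtain h | ⟨pats, rhs, hρ, σ, -, h, hr⟩ := eval_op_iff.1 h
  · exact .inl h
  · exact .inr ⟨pats, rhs, (hQ _ _ _).1 hρ, σ, h, hr⟩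

variable {a b c t : Expr (sortSig S)}

theorem eval_leq_true_iff (hQ : ExtendsSort Q) : Eval Q (eLeq a b) eTrue ↔
    ∃ i j : ℤ, Eval Q a (eInt i) ∧ Eval Q b (eInt j) ∧ i ≤ j := by
  constructor
  · intro h
    obtain h | ⟨pats, rhs, hρ, σ, h, hr⟩ := exists_rule_of_eval hQ h
    · cases h
    · cases hρ with
      | leq_tt i j hij =>
        exact ⟨i, j, (h (0 : Fin 2)).congr_right (subst_pcon_int σ i),
          (h (1 : Fin 2)).congr_right (subst_pcon_int σ j), hij⟩
      | leq_ff i j hij =>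
        cases hr
  · rintro ⟨i, j, ha, hb, hij⟩
    refine eval_of_rule hQ (.leq_tt i j hij) [] (by simp) (Fin.forall_fin_two.2
      ⟨ha.congr_right (subst_pcon_int _ i).symm, hb.congr_right (subst_pcon_int _ j).symm⟩) ?_
    rw [subst_eTrue]
    exact eval_eTrue

theorem eval_leq_false_iff (hQ : ExtendsSort Q) : Eval Q (eLeq a b) eFalse ↔
    ∃ i j : ℤ, Eval Q a (eInt i) ∧ Eval Q b (eInt j) ∧ j < i := by
  constructor
  · intro h
    obtain h | ⟨pats, rhs, hρ, σ, h, hr⟩ := exists_rule_of_eval hQ h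
    · cases h
    · cases hρ with
      | leq_tt i j hij =>
        cases hr
      | leq_ff i j hij =>
        exact ⟨i, j, (h (0 : Fin 2)).congr_right (subst_pcon_int σ i),
          (h (1 : Fin 2)).congr_right (subst_pcon_int σ j), hij⟩
  · rintro ⟨i, j, ha, hb, hij⟩
    refine eval_of_rule hQ (.leq_ff i j hij) [] (by simp) (Fin.forall_fin_two.2
      ⟨ha.congr_right (subst_pcon_int _ i).symm, hb.congr_right (subst_pcon_int _ j).symm⟩) ?_
    rw [subst_eFalse]
    exact eval_eFalse

theorem eval_and_true_iff (hQ : ExtendsSort Q) : Eval Q (eAnd a b) eTrue ↔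
    Eval Q a eTrue ∧ Eval Q b eTrue := by
  constructor
  · intro h
    obtain h | ⟨pats, rhs, hρ, σ, h, hr⟩ := exists_rule_of_eval hQ h
    · cases h
    · cases hρ with
      -- The right-hand side is the bound variable, so the argument evaluates to its binding and the
      -- binding to the result. The other projection rules work the same way.
      | and_tt => exact ⟨(h (0 : Fin 2)).congr_right (subst_pcon_tt σ), (h (1 : Fin 2)).trans hr⟩
      | and_ff => cases hr
  · rintro ⟨ha, hb⟩
    exact eval_of_rule hQ .and_tt [eTrue] (by simpa using hb.isPartialValue)
      (Fin.forall_fin_two.2 ⟨ha.congr_right (subst_pcon_tt _).symm, hb⟩) eval_eTrue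

theorem eval_ite_iff (hQ : ExtendsSort Q) : Eval Q (eIte a b c) t ↔
    t = .bot ∨ (Eval Q a eTrue ∧ Eval Q b t) ∨ (Eval Q a eFalse ∧ Eval Q c t) := by
  constructor
  · intro h
    obtain h | ⟨pats, rhs, hρ, σ, h, hr⟩ := exists_rule_of_eval hQ h
    · exact .inl h
    · cases hρ with
      | ite_tt =>
        exact .inr (.inl ⟨(h (0 : Fin 3)).congr_right (subst_pcon_tt σ), (h (1 : Fin 3)).trans hr⟩)
      | ite_ff =>
        exact .inr (.inr ⟨(h (0 : Fin 3)).congr_right (subst_pcon_ff σ), (h (2 : Fin 3)).trans hr⟩)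
  · rintro (rfl | ⟨ha, hb⟩ | ⟨ha, hc⟩)
    · exact .bot _
    -- The branch not taken is bound to ⊥, to which everything evaluates: variable 1 lies beyond the
    -- list `[t]` and gets the default ⊥.
    · exact eval_of_rule hQ .ite_tt [t] (by simpa using hb.isPartialValue) (forall_fin_three.2
        ⟨ha.congr_right (subst_pcon_tt _).symm, hb, .bot _⟩) hb.isPartialValue.eval_self
    · exact eval_of_rule hQ .ite_ff [.bot, t] (by simpa [IsPartialValue.bot] using hc.isPartialValue)
        (forall_fin_three.2 ⟨ha.congr_right (subst_pcon_ff _).symm, .bot _, hc⟩)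
        hc.isPartialValue.eval_self

theorem eval_ifthen_iff (hQ : ExtendsSort Q) : Eval Q (eIfthen a b) t ↔
    t = .bot ∨ (Eval Q a eTrue ∧ Eval Q b t) := by
  constructor
  · intro h
    obtain h | ⟨pats, rhs, hρ, σ, h, hr⟩ := exists_rule_of_eval hQ h
    · exact .inl h
    · cases hρ with
      | ifthen_tt =>
        exact .inr ⟨(h (0 : Fin 2)).congr_right (subst_pcon_tt σ), (h (1 : Fin 2)).trans hr⟩
  · rintro (rfl | ⟨ha, hb⟩)
    · exact .bot _
    · exact eval_of_rule hQ .ifthen_tt [t] (by simpa using hb.isPartialValue)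
        (Fin.forall_fin_two.2 ⟨ha.congr_right (subst_pcon_tt _).symm, hb⟩)
        hb.isPartialValue.eval_self

/-- Call-time choice shows in the form: the right-hand sides mention the chosen partial values `x`,
`y`, `ys` and not the possibly nondeterministic `a`, `b`. -/
theorem eval_insert_iff (hQ : ExtendsSort Q) : Eval Q (eInsert a b) t ↔
    t = .bot ∨ (∃ x ys, Eval Q a x ∧ Eval Q b ys ∧ Eval Q (eCons x ys) t) ∨
      ∃ x y ys, Eval Q a x ∧ Eval Q b (eCons y ys) ∧ Eval Q (eCons y (eInsert x ys)) t := by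
  constructor
  · intro h
    obtain h | ⟨pats, rhs, hρ, σ, h, hr⟩ := exists_rule_of_eval hQ h
    · exact .inl h
    · cases hρ with
      | insert_here =>
        rw [subst_eCons] at hr
        exact .inr (.inl ⟨_, _, h (0 : Fin 2), h (1 : Fin 2), hr⟩)
      | insert_there =>
        rw [subst_eCons, subst_eInsert] at hr
        exact .inr (.inr ⟨_, _, _, h (0 : Fin 2),
          (h (1 : Fin 2)).congr_right (subst_pcon_cons σ _ _), hr⟩)
  · rintro (rfl | ⟨x, ys, ha, hb, hr⟩ | ⟨x, y, ys, ha, hb, hr⟩)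
    · exact .bot _
    · refine eval_of_rule hQ .insert_here [x, ys]
        (by simp [ha.isPartialValue, hb.isPartialValue]) (Fin.forall_fin_two.2 ⟨ha, hb⟩) ?_
      rwa [subst_eCons]
    · refine eval_of_rule hQ .insert_there [x, y, ys]
        (by simp [ha.isPartialValue, isPartialValue_eCons_iff.1 hb.isPartialValue])
        (Fin.forall_fin_two.2 ⟨ha,
          hb.congr_right (subst_pcon_cons (listSubst [x, y, ys]) (.var 1) (.var 2)).symm⟩) ?_
      rwa [subst_eCons, subst_eInsert]

theorem eval_perm_iff (hQ : ExtendsSort Q) : Eval Q (ePerm a) t ↔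
    t = .bot ∨ (Eval Q a eNil ∧ Eval Q eNil t) ∨
      ∃ x xs, Eval Q a (eCons x xs) ∧ Eval Q (eInsert x (ePerm xs)) t := by
  constructor
  · intro h
    obtain h | ⟨pats, rhs, hρ, σ, h, hr⟩ := exists_rule_of_eval hQ h
    · exact .inl h
    · cases hρ with
      | perm_nil =>
        rw [subst_eNil] at hr
        exact .inr (.inl ⟨(h (0 : Fin 1)).congr_right (subst_pcon_nil σ), hr⟩)
      | perm_cons =>
        rw [subst_eInsert, subst_ePerm] at hr
        exact .inr (.inr ⟨_, _, (h (0 : Fin 1)).congr_right (subst_pcon_cons σ _ _), hr⟩)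
  · rintro (rfl | ⟨ha, hr⟩ | ⟨x, xs, ha, hr⟩)
    · exact .bot _
    · refine eval_of_rule hQ .perm_nil [] (by simp)
        (Fin.forall_fin_one.2 (ha.congr_right (subst_pcon_nil _).symm)) ?_
      rwa [subst_eNil]
    · refine eval_of_rule hQ .perm_cons [x, xs]
        (by simp [isPartialValue_eCons_iff.1 ha.isPartialValue])
        (Fin.forall_fin_one.2
          (ha.congr_right (subst_pcon_cons (listSubst [x, xs]) (.var 0) (.var 1)).symm)) ?_
      rwa [subst_eInsert, subst_ePerm]

theorem eval_sorted_true_iff (hQ : ExtendsSort Q) : Eval Q (eSorted a) eTrue ↔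
    Eval Q a eNil ∨ (∃ x, Eval Q a (eCons x eNil)) ∨
      ∃ x y zs, Eval Q a (eCons x (eCons y zs)) ∧ Eval Q (eLeq x y) eTrue ∧
        Eval Q (eSorted (eCons y zs)) eTrue := by
  constructor
  · intro h
    obtain h | ⟨pats, rhs, hρ, σ, h, hr⟩ := exists_rule_of_eval hQ h
    · cases h
    · cases hρ with
      | sorted_nil => exact .inl ((h (0 : Fin 1)).congr_right (subst_pcon_nil σ))
      | sorted_one =>
        refine .inr (.inl ⟨σ 0, (h (0 : Fin 1)).congr_right ((subst_pcon_cons σ _ _).trans ?_)⟩)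
        rw [subst_pcon_nil]
        rfl
      | sorted_cons =>
        rw [subst_eAnd, subst_eLeq, subst_eSorted, subst_eCons, eval_and_true_iff hQ] at hr
        refine .inr (.inr ⟨_, _, _, (h (0 : Fin 1)).congr_right
          ((subst_pcon_cons σ _ _).trans ?_), hr.1, hr.2⟩)
        rw [subst_pcon_cons]
        rfl
  · rintro (ha | ⟨x, ha⟩ | ⟨x, y, zs, ha, hr⟩)
    · refine eval_of_rule hQ .sorted_nil [] (by simp)
        (Fin.forall_fin_one.2 (ha.congr_right (subst_pcon_nil _).symm)) ?_
      rw [subst_eTrue]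
      exact eval_eTrue
    · refine eval_of_rule hQ .sorted_one [x]
        (by simp [isPartialValue_eCons_iff.1 ha.isPartialValue])
        (Fin.forall_fin_one.2 (ha.congr_right (.trans ?_ (subst_pcon_cons _ _ _).symm))) ?_
      · rw [subst_pcon_nil]
        rfl
      · rw [subst_eTrue]
        exact eval_eTrue
    · have hp := isPartialValue_eCons_iff.1 ha.isPartialValue
      refine eval_of_rule hQ .sorted_cons [x, y, zs]
        (by simp [hp.1, isPartialValue_eCons_iff.1 hp.2])
        (Fin.forall_fin_one.2 (ha.congr_right (.trans ?_ (subst_pcon_cons _ _ _).symm))) ?_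
      · rw [subst_pcon_cons]
        rfl
      · rwa [subst_eAnd, subst_eLeq, subst_eSorted, subst_eCons, eval_and_true_iff hQ]

theorem eval_sortSpec_iff (hQ : ExtendsSort Q) : Eval Q (eSortSpec a) t ↔
    t = .bot ∨ ∃ x, Eval Q a x ∧ Eval Q (eSortSpecWhere (ePerm x)) t := by
  constructor
  · intro h
    obtain h | ⟨pats, rhs, hρ, σ, h, hr⟩ := exists_rule_of_eval hQ h
    · exact .inl h
    · cases hρ with
      | sortSpec =>
        rw [subst_eSortSpecWhere, subst_ePerm] at hr
        exact .inr ⟨_, h (0 : Fin 1), hr⟩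
  · rintro (rfl | ⟨x, ha, hr⟩)
    · exact .bot _
    · refine eval_of_rule hQ .sortSpec [x] (by simpa using ha.isPartialValue)
        (Fin.forall_fin_one.2 ha) ?_
      rwa [subst_eSortSpecWhere, subst_ePerm]

theorem eval_sortSpecWhere_iff (hQ : ExtendsSort Q) : Eval Q (eSortSpecWhere a) t ↔
    t = .bot ∨ ∃ y, Eval Q a y ∧ Eval Q (eSorted y) eTrue ∧ Eval Q y t := by
  constructor
  · intro h
    obtain h | ⟨pats, rhs, hρ, σ, h, hr⟩ := exists_rule_of_eval hQ h
    · exact .inl h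
    · cases hρ with
      | sortSpecWhere =>
        rw [subst_eIfthen, subst_eSorted, eval_ifthen_iff hQ] at hr
        exact hr.imp_right fun hr => ⟨_, h (0 : Fin 1), hr⟩
  · rintro (rfl | ⟨y, ha, hr⟩)
    · exact .bot _
    · refine eval_of_rule hQ .sortSpecWhere [y] (by simpa using ha.isPartialValue)
        (Fin.forall_fin_one.2 ha) ?_
      rw [subst_eIfthen, subst_eSorted, eval_ifthen_iff hQ]
      exact .inr hr

theorem eval_minRest_iff (hQ : ExtendsSort Q) : Eval Q (eMinRest a b c) t ↔
    t = .bot ∨ (∃ m rs, Eval Q a m ∧ Eval Q b rs ∧ Eval Q c eNil ∧ Eval Q (ePair m rs) t) ∨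
      ∃ m rs y ys, Eval Q a m ∧ Eval Q b rs ∧ Eval Q c (eCons y ys) ∧
        Eval Q (eIte (eLeq m y) (eMinRest m (eCons y rs) ys) (eMinRest y (eCons m rs) ys)) t := by
  constructor
  · intro h
    obtain h | ⟨pats, rhs, hρ, σ, h, hr⟩ := exists_rule_of_eval hQ h
    · exact .inl h
    · cases hρ with
      | minRest_nil =>
        rw [subst_ePair] at hr
        exact .inr (.inl ⟨_, _, h (0 : Fin 3), h (1 : Fin 3),
          (h (2 : Fin 3)).congr_right (subst_pcon_nil σ), hr⟩)
      | minRest_cons =>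
        rw [subst_eIte, subst_eLeq, subst_eMinRest, subst_eMinRest, subst_eCons,
          subst_eCons] at hr
        exact .inr (.inr ⟨_, _, _, _, h (0 : Fin 3), h (1 : Fin 3),
          (h (2 : Fin 3)).congr_right (subst_pcon_cons σ _ _), hr⟩)
  · rintro (rfl | ⟨m, rs, ha, hb, hc, hr⟩ | ⟨m, rs, y, ys, ha, hb, hc, hr⟩)
    · exact .bot _
    · refine eval_of_rule hQ .minRest_nil [m, rs]
        (by simp [ha.isPartialValue, hb.isPartialValue])
        (forall_fin_three.2 ⟨ha, hb, hc.congr_right (subst_pcon_nil _).symm⟩) ?_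
      rwa [subst_ePair]
    · refine eval_of_rule hQ .minRest_cons [m, rs, y, ys]
        (by simp [ha.isPartialValue, hb.isPartialValue,
          isPartialValue_eCons_iff.1 hc.isPartialValue])
        (forall_fin_three.2 ⟨ha, hb,
          hc.congr_right (subst_pcon_cons (listSubst [m, rs, y, ys]) (.var 2) (.var 3)).symm⟩) ?_
      rwa [subst_eIte, subst_eLeq, subst_eMinRest, subst_eMinRest, subst_eCons, subst_eCons]

theorem eval_sortCase_iff (hQ : ExtendsSort Q) : Eval Q (eSortCase a) t ↔
    t = .bot ∨ ∃ m r, Eval Q a (ePair m r) ∧ Eval Q (eCons m (eSort r)) t := by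
  constructor
  · intro h
    obtain h | ⟨pats, rhs, hρ, σ, h, hr⟩ := exists_rule_of_eval hQ h
    · exact .inl h
    · cases hρ with
      | sortCase =>
        rw [subst_eCons, subst_eSort] at hr
        exact .inr ⟨_, _, (h (0 : Fin 1)).congr_right (subst_pcon_pair σ _ _), hr⟩
  · rintro (rfl | ⟨m, r, ha, hr⟩)
    · exact .bot _
    · have hp := eval_ePair_ePair.1 (ha.isPartialValue.eval_self (P := Q))
      refine eval_of_rule hQ .sortCase [m, r]
        (by simp [hp.1.isPartialValue, hp.2.isPartialValue])
        (Fin.forall_fin_one.2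
          (ha.congr_right (subst_pcon_pair (listSubst [m, r]) (.var 0) (.var 1)).symm)) ?_
      rwa [subst_eCons, subst_eSort]

theorem eval_sort_iff (hQ : ExtendsSort Q) : Eval Q (eSort a) t ↔
    t = .bot ∨ (Eval Q a eNil ∧ Eval Q eNil t) ∨
      ∃ x xs, Eval Q a (eCons x xs) ∧ Eval Q (eSortCase (eMinRest x eNil xs)) t := by
  constructor
  · intro h
    obtain h | ⟨pats, rhs, hρ, σ, h, hr⟩ := exists_rule_of_eval hQ h
    · exact .inl h
    · cases hρ with
      | sort_nil =>
        rw [subst_eNil] at hr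
        exact .inr (.inl ⟨(h (0 : Fin 1)).congr_right (subst_pcon_nil σ), hr⟩)
      | sort_cons =>
        rw [subst_eSortCase, subst_eMinRest, subst_eNil] at hr
        exact .inr (.inr ⟨_, _, (h (0 : Fin 1)).congr_right (subst_pcon_cons σ _ _), hr⟩)
  · rintro (rfl | ⟨ha, hr⟩ | ⟨x, xs, ha, hr⟩)
    · exact .bot _
    · refine eval_of_rule hQ .sort_nil [] (by simp)
        (Fin.forall_fin_one.2 (ha.congr_right (subst_pcon_nil _).symm)) ?_
      rwa [subst_eNil]
    · refine eval_of_rule hQ .sort_cons [x, xs]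
        (by simp [isPartialValue_eCons_iff.1 ha.isPartialValue])
        (Fin.forall_fin_one.2
          (ha.congr_right (subst_pcon_cons (listSubst [x, xs]) (.var 0) (.var 1)).symm)) ?_
      rwa [subst_eSortCase, subst_eMinRest, subst_eNil]

end Unfolding

/-! ### List expressions and the permutation operations -/

section Lists

variable {S : Signature.{u}} {Q : Set (Rule (sortSig S))} {a b c t : Expr (sortSig S)}
  {l l' : List (Expr (sortSig S))}

/-- The expression of a list of expressions. -/
def eList : List (Expr (sortSig S)) → Expr (sortSig S)
  | [] => eNil
  | a :: l => eCons a (eList l)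

/-- The expression of a list of integers. -/
def eInts (k : List ℤ) : Expr (sortSig S) := eList (k.map (eInt (S := S)))

theorem eInts_cons (i : ℤ) (k : List ℤ) :
    eInts (S := S) (i :: k) = eCons (eInt i) (eInts k) := rfl

/-- Both expressions are integers, and the first is at most the second. -/
def IntLE (a b : Expr (sortSig S)) : Prop := ∃ i j : ℤ, a = eInt i ∧ b = eInt j ∧ i ≤ j

theorem eCons_inj {d : Expr (sortSig S)} (h : eCons a b = eCons c d) : a = c ∧ b = d := by
  injection h with _ h
  exact ⟨congrFun h (0 : Fin 2), congrFun h (1 : Fin 2)⟩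

theorem eInt_injective : Function.Injective (eInt (S := S)) := by
  intro i j h
  injection h with h
  injection h with h
  injection h

theorem eInts_injective : Function.Injective (eInts (S := S)) := by
  intro k k' h
  induction k generalizing k' with
  | nil =>
    cases k' with
    | nil => rfl
    | cons _ _ => cases h
  | cons i k ih =>
    cases k' with
    | nil => cases h
    | cons j k' =>
      obtain ⟨h₁, h₂⟩ := eCons_inj h
      rw [eInt_injective h₁, ih h₂]

theorem eval_eInts_self (k : List ℤ) : Eval Q (eInts (S := S) k) (eInts k) := by
  induction k with
  | nil => exact eval_eNil
  | cons i k ih => exact eval_eCons_eCons.2 ⟨eval_eInt i, ih⟩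

theorem isPartialValue_eList_iff : IsPartialValue (eList l) ↔ ∀ a ∈ l, IsPartialValue a := by
  induction l with
  -- Being a partial value does not depend on a program, so any program serves here.
  | nil => exact iff_of_true (eval_eNil (S := S) (Q := ∅)).isPartialValue (by simp)
  | cons a l ih => rw [eList, isPartialValue_eCons_iff, ih, List.forall_mem_cons]

theorem eq_nil_of_eval_eNil (h : Eval Q eNil (eList l)) : l = [] := by
  cases l with
  | nil => rfl
  | cons a' l' => cases h

/-- Induction is on the resulting list, the only list at hand since `b` is arbitrary. Elements may
lose information on the way, and transitivity pushes that loss back into the evaluation of `b`. -/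
theorem exists_perm_of_eval_insert (hQ : ExtendsSort Q) (h : Eval Q (eInsert a b) (eList l)) :
    ∃ a' l', Eval Q a a' ∧ Eval Q b (eList l') ∧ (a' :: l').Perm l := by
  induction l generalizing a b with
  | nil =>
    obtain h | ⟨x, ys, -, -, h⟩ | ⟨x, y, ys, -, -, h⟩ := (eval_insert_iff hQ).1 h <;> cases h
  | cons c l ih =>
    obtain h | ⟨x, ys, hx, hys, h⟩ | ⟨x, y, ys, hx, hys, h⟩ := (eval_insert_iff hQ).1 h
    · cases h
    · obtain ⟨h₁, h₂⟩ := eval_eCons_eCons.1 h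
      exact ⟨c, l, hx.trans h₁, hys.trans h₂, .refl _⟩
    · obtain ⟨h₁, h₂⟩ := eval_eCons_eCons.1 h
      obtain ⟨a', l', ha', hl', hp⟩ := ih h₂
      exact ⟨a', c :: l', hx.trans ha', hys.trans (eval_eCons_eCons.2 ⟨h₁, hl'⟩),
        (List.Perm.swap _ _ _).trans (hp.cons c)⟩

/-- Each `insert` adds exactly one element, so the recursive call has a result shorter by one; this
gives an induction on the length of the result. -/
theorem exists_perm_of_eval_perm (hQ : ExtendsSort Q) (h : Eval Q (ePerm a) (eList l)) :
    ∃ l', Eval Q a (eList l') ∧ l'.Perm l := by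
  induction hn : l.length generalizing a l with
  | zero =>
    obtain rfl := List.length_eq_zero_iff.1 hn
    obtain h | ⟨ha, -⟩ | ⟨x, xs, ha, h⟩ := (eval_perm_iff hQ).1 h
    · cases h
    · exact ⟨[], ha, .refl _⟩
    · obtain ⟨_, _, _, _, hp⟩ := exists_perm_of_eval_insert hQ h
      simpa using hp.length_eq
  | succ n ih =>
    obtain h | ⟨-, h⟩ | ⟨x, xs, ha, h⟩ := (eval_perm_iff hQ).1 h
    · cases l <;> cases h
    · simp [eq_nil_of_eval_eNil h] at hn
    · obtain ⟨x', l₁, hx', hl₁, hp⟩ := exists_perm_of_eval_insert hQ h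
      obtain ⟨l₂, hl₂, hp₂⟩ := ih hl₁ (by simpa [hn] using hp.length_eq)
      exact ⟨x' :: l₂, ha.trans (eval_eCons_eCons.2 ⟨hx', hl₂⟩), (hp₂.cons _).trans hp⟩

/-- The prefix `s` dictates the choices: skip one element of the list for each element of `s`, then
insert. -/
theorem eval_insert_append (hQ : ExtendsSort Q) {s r : List (Expr (sortSig S))}
    (ha : IsPartialValue a) (h : Eval Q b (eList (s ++ r))) :
    Eval Q (eInsert a b) (eList (s ++ a :: r)) := by
  induction s generalizing b with
  | nil =>
    exact (eval_insert_iff hQ).2 <| .inr <| .inl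
      ⟨a, _, ha.eval_self, h, eval_eCons_eCons.2 ⟨ha.eval_self, h.isPartialValue.eval_self⟩⟩
  | cons c s ih =>
    obtain ⟨hc, hs⟩ := isPartialValue_eCons_iff.1 h.isPartialValue
    exact (eval_insert_iff hQ).2 <| .inr <| .inr
      ⟨a, c, _, ha.eval_self, h, eval_eCons_eCons.2 ⟨hc.eval_self, ih hs.eval_self⟩⟩

theorem eval_perm_of_perm (hQ : ExtendsSort Q) (hl : ∀ a ∈ l, IsPartialValue a)
    (hp : l.Perm l') : Eval Q (ePerm (eList l)) (eList l') := by
  induction l generalizing l' with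
  | nil =>
    rw [List.nil_perm.1 hp]
    exact (eval_perm_iff hQ).2 (.inr (.inl ⟨eval_eNil, eval_eNil⟩))
  | cons a l ih =>
    obtain ⟨s, r, rfl⟩ := List.append_of_mem (hp.subset List.mem_cons_self)
    obtain ⟨ha, hl⟩ := List.forall_mem_cons.1 hl
    exact (eval_perm_iff hQ).2 <| .inr <| .inr
      ⟨a, eList l, eval_eCons_eCons.2 ⟨ha.eval_self, (isPartialValue_eList_iff.2 hl).eval_self⟩,
        eval_insert_append hQ ha (ih hl (hp.trans List.perm_middle).cons_inv)⟩

theorem eval_sorted_mono (h : Eval Q b c) (hc : Eval Q (eSorted c) t) : Eval Q (eSorted b) t :=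
  hc.op_mono (Fin.forall_fin_one.2 fun _ => h.trans)

theorem eval_sort_mono (h : Eval Q b c) (hc : Eval Q (eSort c) t) : Eval Q (eSort b) t :=
  hc.op_mono (Fin.forall_fin_one.2 fun _ => h.trans)

theorem eval_minRest_mono {a' b' c' : Expr (sortSig S)} (ha : Eval Q a a') (hb : Eval Q b b')
    (hc : Eval Q c c') (h : Eval Q (eMinRest a' b' c') t) : Eval Q (eMinRest a b c) t :=
  h.op_mono (forall_fin_three.2 ⟨fun _ => ha.trans, fun _ => hb.trans, fun _ => hc.trans⟩)

/-! ### The test `sorted` and the specification -/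

/-- Reaching `True` exhausts the spine and compares all neighbours. A chain of length one carries no
condition, matching the rule that accepts singletons unseen. -/
theorem exists_isChain_of_eval_sorted (hQ : ExtendsSort Q) (ha : IsPartialValue a)
    (h : Eval Q (eSorted a) eTrue) : ∃ l, a = eList l ∧ l.IsChain IntLE := by
  suffices H : ∀ a : Expr (sortSig S), IsPartialValue a → Eval Q (eSorted a) eTrue →
      ∃ l, a = eList l ∧ l.IsChain IntLE from H a ha h
  clear ha h
  intro a ha
  induction ha with
  | bot =>
    intro h
    obtain h | ⟨x, h⟩ | ⟨x, y, zs, h, -⟩ := (eval_sorted_true_iff hQ).1 h <;> cases h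
  | con k args hargs ih =>
    intro h
    have hp : IsPartialValue (.con k args) := .con k args hargs
    obtain h | ⟨x, h⟩ | ⟨x, y, zs, h, hxy, hs⟩ := (eval_sorted_true_iff hQ).1 h
    · exact ⟨[], hp.eq_eNil h, .nil⟩
    · obtain ⟨x', y', he, -, hy, -, h'⟩ := hp.exists_eq_eCons h
      rw [he, hy.eq_eNil h']
      exact ⟨[x'], rfl, .singleton _⟩
    · obtain ⟨x', q, he, hx', hq, hx, h'⟩ := hp.exists_eq_eCons h
      obtain ⟨y', zs', rfl, hy', -, hy, -⟩ := hq.exists_eq_eCons h'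
      cases he
      -- Position 1 of the cons cell is the tail; the test succeeded on an approximation of it,
      -- hence also on the tail itself.
      obtain ⟨l, hl, hc⟩ := ih (1 : Fin 2) (eval_sorted_mono h' hs)
      obtain ⟨i, j, hi, hj, hij⟩ := (eval_leq_true_iff hQ).1 hxy
      cases l with
      | nil => cases hl
      | cons y'' l =>
        obtain ⟨rfl, rfl⟩ := eCons_inj hl
        exact ⟨x' :: y' :: l, rfl, .cons_cons
          ⟨i, j, hx'.eq_eInt (hx.trans hi), hy'.eq_eInt (hy.trans hj), hij⟩ hc⟩

theorem eval_sorted_of_isChain (hQ : ExtendsSort Q) (hl : ∀ a ∈ l, IsPartialValue a)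
    (hc : l.IsChain IntLE) : Eval Q (eSorted (eList l)) eTrue := by
  induction hc with
  | nil => exact (eval_sorted_true_iff hQ).2 (.inl eval_eNil)
  | singleton a =>
    exact (eval_sorted_true_iff hQ).2
      (.inr (.inl ⟨a, (isPartialValue_eList_iff.2 hl).eval_self⟩))
  | cons_cons hab _ ih =>
    obtain ⟨i, j, rfl, rfl, hij⟩ := hab
    exact (eval_sorted_true_iff hQ).2 <| .inr <| .inr
      ⟨_, _, _, (isPartialValue_eList_iff.2 hl).eval_self,
        (eval_leq_true_iff hQ).2 ⟨i, j, eval_eInt i, eval_eInt j, hij⟩,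
        ih (List.forall_mem_cons.1 hl).2⟩

/-- `a` evaluates to a list that has a sorted permutation evaluating to `t`. -/
def EvalSorted (Q : Set (Rule (sortSig S))) (a t : Expr (sortSig S)) : Prop :=
  ∃ l l', Eval Q a (eList l) ∧ l.Perm l' ∧ l'.IsChain IntLE ∧ Eval Q (eList l') t

/-- Sharing is essential: the value `y` that passes the test is the value returned. -/
theorem eval_sortSpec_iff_evalSorted (hQ : ExtendsSort Q) :
    Eval Q (eSortSpec a) t ↔ t = .bot ∨ EvalSorted Q a t := by
  rw [eval_sortSpec_iff hQ]
  refine or_congr_right' fun ht => ?_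
  simp only [eval_sortSpecWhere_iff hQ, ht, false_or]
  constructor
  · rintro ⟨x, hx, y, hy, hs, hyt⟩
    obtain ⟨l', rfl, hc⟩ := exists_isChain_of_eval_sorted hQ hy.isPartialValue hs
    obtain ⟨l, hl, hp⟩ := exists_perm_of_eval_perm hQ hy
    exact ⟨l, l', hx.trans hl, hp, hc, hyt⟩
  · rintro ⟨l, l', hl, hp, hc, ht⟩
    have hl' := isPartialValue_eList_iff.1 hl.isPartialValue
    exact ⟨_, hl, _, eval_perm_of_perm hQ hl' hp,
      eval_sorted_of_isChain hQ (fun a ha => hl' a (hp.symm.subset ha)) hc, ht⟩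

/-! ### Selection of the minimum -/

/-- The result of `minRest` on integers. -/
def minRestInt (m : ℤ) (rs : List ℤ) : List ℤ → ℤ × List ℤ
  | [] => (m, rs)
  | y :: ys => if m ≤ y then minRestInt m (y :: rs) ys else minRestInt y (m :: rs) ys

theorem minRestInt_perm (m : ℤ) (rs k : List ℤ) :
    ((minRestInt m rs k).1 :: (minRestInt m rs k).2).Perm (m :: (rs ++ k)) := by
  induction k generalizing m rs with
  | nil => simp [minRestInt]
  | cons y ys ih =>
    rw [minRestInt]
    split_ifs
    · exact (ih _ _).trans (List.perm_middle.symm.cons m)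
    · exact (ih _ _).trans ((List.Perm.swap _ _ _).trans (List.perm_middle.symm.cons m))

/-- The hypothesis is the loop invariant: the candidate is a lower bound of everything set aside. -/
theorem minRestInt_fst_le (m : ℤ) (rs k : List ℤ) (h : ∀ j ∈ rs, m ≤ j) :
    ∀ j ∈ (minRestInt m rs k).2, (minRestInt m rs k).1 ≤ j := by
  induction k generalizing m rs with
  | nil => exact h
  | cons y ys ih =>
    rw [minRestInt]
    split_ifs with hy
    · exact ih _ _ (List.forall_mem_cons.2 ⟨hy, h⟩)
    · have hy := (not_le.1 hy).le
      exact ih _ _ (List.forall_mem_cons.2 ⟨hy, fun j hj => hy.trans (h j hj)⟩)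

theorem length_minRestInt_snd (m : ℤ) (k : List ℤ) :
    (minRestInt m [] k).2.length = k.length := by
  simpa using (minRestInt_perm m [] k).length_eq

/-- Both sides are sorted and are permutations of each other, hence equal. This gives
`List.insertionSort` the recursion of selection sort. -/
theorem insertionSort_cons_eq (m : ℤ) (k : List ℤ) :
    (m :: k).insertionSort (· ≤ ·) =
      (minRestInt m [] k).1 :: (minRestInt m [] k).2.insertionSort (· ≤ ·) := by
  refine List.Perm.eq_of_pairwise' (r := (· ≤ ·)) (List.pairwise_insertionSort _ _)
    (List.pairwise_cons.2 ⟨fun j hj => minRestInt_fst_le m [] k (by simp) j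
      (by simpa using hj), List.pairwise_insertionSort _ _⟩) ?_
  exact (List.perm_insertionSort _ _).trans <|
    (minRestInt_perm m [] k).symm.trans ((List.perm_insertionSort _ _).symm.cons _)

theorem eval_minRest_eInts (hQ : ExtendsSort Q) (m : ℤ) (rs k : List ℤ) :
    Eval Q (eMinRest (eInt m) (eInts rs) (eInts k))
      (ePair (eInt (minRestInt m rs k).1) (eInts (minRestInt m rs k).2)) := by
  induction k generalizing m rs with
  | nil =>
    exact (eval_minRest_iff hQ).2 <| .inr <| .inl ⟨_, _, eval_eInt m, eval_eInts_self rs,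
      eval_eNil, eval_ePair_ePair.2 ⟨eval_eInt m, eval_eInts_self rs⟩⟩
  | cons y ys ih =>
    refine (eval_minRest_iff hQ).2 <| .inr <| .inr ⟨_, _, _, _, eval_eInt m, eval_eInts_self rs,
      eval_eInts_self (y :: ys), (eval_ite_iff hQ).2 (.inr ?_)⟩
    rw [minRestInt]
    split_ifs with hy
    · exact .inl ⟨(eval_leq_true_iff hQ).2 ⟨m, y, eval_eInt m, eval_eInt y, hy⟩, ih m (y :: rs)⟩
    · exact .inr ⟨(eval_leq_false_iff hQ).2 ⟨m, y, eval_eInt m, eval_eInt y, not_le.1 hy⟩,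
        ih y (m :: rs)⟩

/-- A pair appears only once `p` is exhausted, and each element passed is compared with the current
candidate. So either `p` is empty and `x` was never inspected, or everything is an integer and the
run is forced. -/
theorem eval_ePair_of_eval_minRest (hQ : ExtendsSort Q) {x p m r : Expr (sortSig S)} {rs : List ℤ}
    (hp : IsPartialValue p) (hx : IsPartialValue x)
    (h : Eval Q (eMinRest x (eInts rs) p) (ePair m r)) :
    (p = eNil ∧ Eval Q x m ∧ Eval Q (eInts rs) r) ∨
      ∃ i k, x = eInt i ∧ p = eInts k ∧ Eval Q (eInt (minRestInt i rs k).1) m ∧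
        Eval Q (eInts (minRestInt i rs k).2) r := by
  induction hp generalizing x rs with
  | bot =>
    obtain h | ⟨_, _, -, -, h, -⟩ | ⟨_, _, _, _, -, -, h, -⟩ := (eval_minRest_iff hQ).1 h <;>
      cases h
  | con c args hargs ih =>
    have hp : IsPartialValue (.con c args) := .con c args hargs
    obtain h | ⟨m', rs', hm, hrs, hn, h⟩ | ⟨x₀, rs', y, ys, hx₀, hrs, hc, hr⟩ :=
      (eval_minRest_iff hQ).1 h
    · cases h
    · obtain ⟨h₁, h₂⟩ := eval_ePair_ePair.1 h
      exact .inl ⟨hp.eq_eNil hn, hm.trans h₁, hrs.trans h₂⟩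
    · obtain ⟨y', q, he, hy', hq, hy, hys⟩ := hp.exists_eq_eCons hc
      cases he
      right
      -- For an integer candidate the two alternatives merge, the empty list being the case `k =
      -- []`.
      have key : ∀ (i : ℤ) (rs' : List ℤ),
          Eval Q (eMinRest (eInt i) (eInts rs') q) (ePair m r) →
          ∃ k, q = eInts k ∧ Eval Q (eInt (minRestInt i rs' k).1) m ∧
            Eval Q (eInts (minRestInt i rs' k).2) r := by
        intro i rs' h
        obtain ⟨h₁, h₂, h₃⟩ | ⟨i', k, hi, h₁, h₂, h₃⟩ :=
          ih (1 : Fin 2) (eval_eInt (Q := Q) i).isPartialValue h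
        · exact ⟨[], h₁, h₂, h₃⟩
        · cases eInt_injective hi
          exact ⟨k, h₁, h₂, h₃⟩
      obtain hr | ⟨hl, hr⟩ | ⟨hl, hr⟩ := (eval_ite_iff hQ).1 hr
      · cases hr
      · obtain ⟨i, j, hi, hj, hij⟩ := (eval_leq_true_iff hQ).1 hl
        -- The comparison saw an integer through approximations, so the original expression is that
        -- integer; monotonicity then moves the recursive call back to it.
        cases hx.eq_eInt (hx₀.trans hi)
        cases hy'.eq_eInt (hy.trans hj)
        obtain ⟨k, rfl, hk⟩ := key i (j :: rs) (eval_minRest_mono hx₀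
          (eval_eCons_eCons.2 ⟨hy, hrs⟩) hys hr)
        refine ⟨i, j :: k, rfl, rfl, ?_⟩
        rwa [minRestInt, if_pos hij]
      · obtain ⟨i, j, hi, hj, hij⟩ := (eval_leq_false_iff hQ).1 hl
        cases hx.eq_eInt (hx₀.trans hi)
        cases hy'.eq_eInt (hy.trans hj)
        obtain ⟨k, rfl, hk⟩ := key j (i :: rs) (eval_minRest_mono hy
          (eval_eCons_eCons.2 ⟨hx₀, hrs⟩) hys hr)
        refine ⟨i, j :: k, rfl, rfl, ?_⟩
        rwa [minRestInt, if_neg (not_le.2 hij)]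

/-! ### Evaluation of `sort` -/

theorem eval_sort_eInts (hQ : ExtendsSort Q) (k : List ℤ) :
    Eval Q (eSort (eInts k)) (eInts (k.insertionSort (· ≤ ·))) := by
  induction hn : k.length generalizing k with
  | zero =>
    obtain rfl := List.length_eq_zero_iff.1 hn
    exact (eval_sort_iff hQ).2 (.inr (.inl ⟨eval_eNil, eval_eNil⟩))
  | succ n ih =>
    cases k with
    | nil => cases hn
    | cons i k =>
      rw [insertionSort_cons_eq]
      refine (eval_sort_iff hQ).2 <| .inr <| .inr ⟨_, _, eval_eInts_self (i :: k),
        (eval_sortCase_iff hQ).2 <| .inr ⟨_, _, eval_minRest_eInts hQ i [] k,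
          eval_eCons_eCons.2 ⟨eval_eInt _, ih _ ?_⟩⟩⟩
      simpa [length_minRestInt_snd] using hn

/-- Determinism on integer lists. Induction is on the length because the recursive call receives the
rest left by `minRest`, which need not be the tail. -/
theorem eval_of_eval_sort_eInts (hQ : ExtendsSort Q) (k : List ℤ)
    (h : Eval Q (eSort (eInts k)) t) : Eval Q (eInts (k.insertionSort (· ≤ ·))) t := by
  induction hn : k.length generalizing k t with
  | zero =>
    obtain rfl := List.length_eq_zero_iff.1 hn
    obtain rfl | ⟨-, h⟩ | ⟨_, _, h, -⟩ := (eval_sort_iff hQ).1 h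
    · exact .bot _
    · exact h
    · cases h
  | succ n ih =>
    cases k with
    | nil => cases hn
    | cons i k =>
      obtain rfl | ⟨h, -⟩ | ⟨x, xs, hx, h⟩ := (eval_sort_iff hQ).1 h
      · exact .bot _
      · cases h
      obtain rfl | ⟨m, r, hm, h⟩ := (eval_sortCase_iff hQ).1 h
      · exact .bot _
      obtain rfl | ⟨m', t', rfl, hm', ht'⟩ := eval_eCons_iff.1 h
      · exact .bot _
      obtain ⟨hx, hxs⟩ := eval_eCons_eCons.1 hx
      rw [insertionSort_cons_eq, eInts_cons, eval_eCons_eCons]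
      have hlen := length_minRestInt_snd i k
      have H : Eval Q (eInt (minRestInt i [] k).1) m ∧ Eval Q (eInts (minRestInt i [] k).2) r := by
        obtain ⟨hk, h₁, h₂⟩ | ⟨i', k', hi, hk, h⟩ := eval_ePair_of_eval_minRest hQ (rs := [])
          (eval_eInts_self (Q := Q) k).isPartialValue (eval_eInt (Q := Q) i).isPartialValue
          (eval_minRest_mono hx eval_eNil hxs hm)
        · cases k with
          | nil => exact ⟨h₁, h₂⟩
          | cons _ _ => cases hk
        · cases eInt_injective hi
          cases eInts_injective hk
          exact h
      exact ⟨H.1.trans hm', ih _ (eval_sort_mono H.2 ht') (by simpa [hlen] using hn)⟩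

/-- With two elements present, each one has a neighbour and so occurs in some `IntLE`; a one-element
chain would not force an integer. -/
theorem exists_map_eInt_of_isChain (h : (a :: b :: l).IsChain IntLE) :
    ∃ k : List ℤ, a :: b :: l = k.map eInt ∧ k.Pairwise (· ≤ ·) := by
  suffices H : ∃ i k, a = eInt i ∧ b :: l = List.map eInt k ∧
      (i :: k).IsChain (· ≤ · : ℤ → ℤ → Prop) by
    obtain ⟨i, k, rfl, hk, hc⟩ := H
    exact ⟨i :: k, by simp [hk], List.isChain_iff_pairwise.1 hc⟩
  induction l generalizing a b with
  | nil =>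
    obtain ⟨i, j, rfl, rfl, hij⟩ := (List.isChain_cons_cons.1 h).1
    exact ⟨i, [j], rfl, rfl, by simpa using hij⟩
  | cons c l ih =>
    obtain ⟨⟨i, j, rfl, hb, hij⟩, h'⟩ := List.isChain_cons_cons.1 h
    obtain ⟨j', k, hj', hk, hc⟩ := ih h'
    cases eInt_injective (hb.symm.trans hj')
    exact ⟨i, j :: k, rfl, by simp [hb, hk], .cons_cons hij hc⟩

theorem isChain_map_eInt {k : List ℤ} (h : k.Pairwise (· ≤ ·)) :
    (k.map (eInt (S := S))).IsChain IntLE :=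
  (List.isChain_map _).2 (h.isChain.imp fun i j hij => ⟨i, j, rfl, rfl, hij⟩)

theorem eval_sort_singleton (hQ : ExtendsSort Q) (ha : IsPartialValue a) :
    Eval Q (eSort (eList [a])) (eList [a]) := by
  refine (eval_sort_iff hQ).2 <| .inr <| .inr
    ⟨a, eNil, eval_eCons_eCons.2 ⟨ha.eval_self, eval_eNil⟩,
      (eval_sortCase_iff hQ).2 <| .inr ⟨a, eNil, ?_, eval_eCons_eCons.2 ⟨ha.eval_self, ?_⟩⟩⟩
  · exact (eval_minRest_iff hQ).2 <| .inr <| .inl ⟨a, eNil, ha.eval_self, eval_eNil, eval_eNil,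
      eval_ePair_ePair.2 ⟨ha.eval_self, eval_eNil⟩⟩
  · exact (eval_sort_iff hQ).2 (.inr (.inl ⟨eval_eNil, eval_eNil⟩))

theorem eval_sort_of_isChain (hQ : ExtendsSort Q) (hl : ∀ a ∈ l, IsPartialValue a)
    (hp : l.Perm l') (hc : l'.IsChain IntLE) : Eval Q (eSort (eList l)) (eList l') := by
  match l', hp, hc with
  | [], hp, _ =>
    rw [hp.eq_nil]
    exact (eval_sort_iff hQ).2 (.inr (.inl ⟨eval_eNil, eval_eNil⟩))
  | [a], hp, _ =>
    obtain rfl := List.perm_singleton.1 hp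
    exact eval_sort_singleton hQ (hl a List.mem_cons_self)
  | a :: b :: l', hp, hc =>
    obtain ⟨k, hk, hs⟩ := exists_map_eInt_of_isChain hc
    rw [hk] at hp ⊢
    obtain ⟨k', rfl⟩ : l ∈ Set.range (List.map (eInt (S := S))) := by
      rw [Set.range_list_map]
      intro x hx
      obtain ⟨i, -, hi⟩ := List.mem_map.1 (hp.subset hx)
      exact ⟨i, hi⟩
    have hk' := (List.map_perm_map_iff eInt_injective).1 hp
    have he : k = k'.insertionSort (· ≤ ·) :=
      List.Perm.eq_of_pairwise' hs (List.pairwise_insertionSort _ _)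
        (hk'.symm.trans (List.perm_insertionSort _ _).symm)
    rw [he]
    exact eval_sort_eInts hQ k'

theorem eval_sort_iff_evalSorted (hQ : ExtendsSort Q) :
    Eval Q (eSort a) t ↔ t = .bot ∨ EvalSorted Q a t := by
  constructor
  · intro h
    obtain h | ⟨ha, h⟩ | ⟨x, xs, ha, h⟩ := (eval_sort_iff hQ).1 h
    · exact .inl h
    · exact .inr ⟨[], [], ha, .refl _, .nil, h⟩
    have hp := isPartialValue_eCons_iff.1 ha.isPartialValue
    -- The choice made in evaluating `a` is fixed here, so that the determinism result applies once
    -- `x` and `xs` are known to be integers.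
    have hs : Eval Q (eSort (eCons x xs)) t :=
      (eval_sort_iff hQ).2 (.inr (.inr ⟨x, xs, ha.isPartialValue.eval_self, h⟩))
    obtain rfl | ⟨m, r, hm, hr⟩ := (eval_sortCase_iff hQ).1 h
    · exact .inl rfl
    right
    -- Either the list is a singleton with an uninspected element, or it consists of integers.
    obtain ⟨rfl, h₁, h₂⟩ | ⟨i, k, rfl, rfl, -⟩ :=
      eval_ePair_of_eval_minRest hQ (rs := []) hp.2 hp.1 hm
    · refine ⟨[x], [x], ha, .refl _, .singleton x, ?_⟩
      obtain rfl | ⟨m', t', rfl, hm', ht'⟩ := eval_eCons_iff.1 hr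
      · exact .bot _
      · exact eval_eCons_eCons.2 ⟨h₁.trans hm',
          eval_of_eval_sort_eInts hQ [] (eval_sort_mono h₂ ht')⟩
    · exact ⟨(i :: k).map eInt, ((i :: k).insertionSort (· ≤ ·)).map eInt, ha,
        (List.perm_insertionSort _ _).symm.map _,
        isChain_map_eInt (List.pairwise_insertionSort _ _),
        eval_of_eval_sort_eInts hQ (i :: k) hs⟩
  · rintro (rfl | ⟨l, l', hl, hp, hc, h⟩)
    · exact .bot _
    · exact (eval_sort_mono hl (eval_sort_of_isChain hQ
        (isPartialValue_eList_iff.1 hl.isPartialValue) hp hc)).trans h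

end Lists

end FLP

theorem mainTheorem8 (S : FLP.Signature.{u}) (P : Set (FLP.Rule (FLP.sortSig S)))
    (hP : ∀ ρ ∈ P, ∃ f : S.Op, ρ.head = Sum.inr f) :
    FLP.Equivalent (FLP.sortProgram S ∪ P)
      (Sum.inl FLP.BaseOp.sort) (Sum.inl FLP.BaseOp.sortSpec) rfl := by
  have hQ := FLP.extendsSort_union hP
  refine FLP.equivalent_of_eval_iff fun args t => ?_
  obtain ⟨a, rfl⟩ : ∃ a, args = ![a] :=
    ⟨args (0 : Fin 1), funext (Fin.forall_fin_one.2 rfl)⟩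
  exact (FLP.eval_sort_iff_evalSorted hQ).trans (FLP.eval_sortSpec_iff_evalSorted hQ).symm
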